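/- Let $k$ be an algebraically closed field, let $r \ge 2$ and $m \ge 1$ be integers, and let $P_1, \dots, P_s$ be $s \le 3m-1$ distinct points of $\mathbf{P}^r(k)$ such that no $m+2$ of them are collinear and no $2m+2$ of them lie on a plane conic, where a plane conic is the zero locus, inside some plane of $\mathbf{P}^r$, of a nonzero quadratic form on that plane (possibly reducible). Then $P_1, \dots, P_s$ are in $m$-general position, that is, they impose independent conditions on forms of degree $m$: the evaluation maps $\mathrm{ev}_{P_1}, \dots, \mathrm{ev}_{P_s}$ are linearly independent in the dual of the space of homogeneous forms of degree $m$ in $r+1$ variables over $k$. Here, for $P = (p_0 : \cdots : p_r)$ and $i$ the smallest index with $p_i \ne 0$, $\mathrm{ev}_P(f) = f(p_0, \dots, p_r)/p_i^m$. -/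

import Mathlib

open scoped LinearAlgebra.Projectivization

noncomputable section

namespace PointConfig

variable {k : Type*} [Field k]

/-- The space of forms (homogeneous polynomials, together with zero) of degree `m` in
the `r + 1` homogeneous coordinates of `ℙ^r` over `k`. -/
abbrev Forms (k : Type*) [Field k] (r m : ℕ) : Submodule k (MvPolynomial (Fin (r + 1)) k) :=
  MvPolynomial.homogeneousSubmodule (Fin (r + 1)) k m

theorem exists_coord_ne_zero {r : ℕ} (v : Fin (r + 1) → k) (hv : v ≠ 0) : ∃ i, v i ≠ 0 :=
  Function.ne_iff.mp hv

open Classical in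
/-- The smallest index of a nonzero coordinate of a nonzero vector. -/
def leadIndex {r : ℕ} (v : Fin (r + 1) → k) (hv : v ≠ 0) : Fin (r + 1) :=
  Fin.find (fun i => v i ≠ 0) (exists_coord_ne_zero v hv)

/-- The evaluation map at the point `P = (p_0 : ... : p_r)`: it sends a form `f` of degree `m` to
`f(p_0, ..., p_r) / p_i ^ m`, where `i` is the smallest index with `p_i ≠ 0`.
It does not depend on the representative of `P`, see `evalAt_mk`. -/
def evalAt {r : ℕ} (m : ℕ) (P : ℙ k (Fin (r + 1) → k)) : Module.Dual k (Forms k r m) :=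
  ((P.rep (leadIndex P.rep P.rep_nonzero) ^ m)⁻¹ : k) •
    ((MvPolynomial.aeval P.rep).toLinearMap ∘ₗ (Forms k r m).subtype)

/-- The points `P_1, ..., P_s` are in `m`-general position (they impose independent conditions on
forms of degree `m`): their evaluation maps are linearly independent in the dual of the space of
forms of degree `m`. -/
def InGeneralPosition {r s : ℕ} (m : ℕ) (P : Fin s → ℙ k (Fin (r + 1) → k)) : Prop :=
  LinearIndependent k (fun i => evalAt m (P i))

/-- The zero locus in `ℙ^2` of a form `F` in three variables. For homogeneous `F` it does not
depend on the choice of representatives, see `mk_mem_zeroLocus`. -/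
def zeroLocus (F : MvPolynomial (Fin 3) k) : Set (ℙ k (Fin 3 → k)) :=
  {Q | MvPolynomial.eval Q.rep F = 0}

/-- A plane conic of `ℙ^r`, possibly reducible: the image, under a linear embedding
`ℙ^2 → ℙ^r`, of the zero locus of a nonzero form of degree `2`. -/
def IsPlaneConic {r : ℕ} (C : Set (ℙ k (Fin (r + 1) → k))) : Prop :=
  ∃ (φ : (Fin 3 → k) →ₗ[k] (Fin (r + 1) → k)) (hφ : Function.Injective φ)
    (F : MvPolynomial (Fin 3) k), F ≠ 0 ∧ F.IsHomogeneous 2 ∧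
      C = Projectivization.map φ hφ '' zeroLocus F

theorem eval_smul_of_homogeneous {n m : ℕ} {f : MvPolynomial (Fin n) k} (hf : f.IsHomogeneous m)
    (a : k) (v : Fin n → k) :
    MvPolynomial.eval (a • v) f = a ^ m * MvPolynomial.eval v f := by
  rw [MvPolynomial.eval_eq, MvPolynomial.eval_eq, Finset.mul_sum]
  refine Finset.sum_congr rfl fun d hd => ?_
  have hdeg : ∑ i ∈ d.support, d i = m := by
    have := hf (MvPolynomial.mem_support_iff.mp hd)
    rw [← this]
    simp [Finsupp.weight_apply, Finsupp.sum]
  simp only [Pi.smul_apply, smul_eq_mul, mul_pow, Finset.prod_mul_distrib,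
    Finset.prod_pow_eq_pow_sum, hdeg]
  ring

theorem mk_mem_zeroLocus {F : MvPolynomial (Fin 3) k} {d : ℕ} (hF : F.IsHomogeneous d)
    (v : Fin 3 → k) (hv : v ≠ 0) :
    Projectivization.mk k v hv ∈ zeroLocus F ↔ MvPolynomial.eval v F = 0 := by
  obtain ⟨a, ha⟩ := Projectivization.exists_smul_eq_mk_rep k v hv
  simp only [zeroLocus, Set.mem_ofPred_eq, ← ha, Units.smul_def, eval_smul_of_homogeneous hF]
  simp

theorem leadIndex_smul {r : ℕ} (a : kˣ) (v w : Fin (r + 1) → k) (hv : v ≠ 0) (hw : w ≠ 0)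
    (h : a • v = w) : leadIndex w hw = leadIndex v hv := by
  subst h
  unfold leadIndex
  congr 1
  funext i
  simp [Units.smul_def]

theorem leadIndex_spec {r : ℕ} (v : Fin (r + 1) → k) (hv : v ≠ 0) :
    v (leadIndex v hv) ≠ 0 ∧ ∀ j < leadIndex v hv, v j = 0 := by
  classical
  refine ⟨Fin.find_spec (p := fun i => v i ≠ 0) (exists_coord_ne_zero v hv), fun j hj => ?_⟩
  by_contra hne
  exact Fin.find_min (p := fun i => v i ≠ 0) (exists_coord_ne_zero v hv) hj hne

theorem evalAt_mk {r m : ℕ} (v : Fin (r + 1) → k) (hv : v ≠ 0) (f : Forms k r m) :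
    evalAt m (Projectivization.mk k v hv) f =
      MvPolynomial.eval v (f : MvPolynomial (Fin (r + 1)) k) / v (leadIndex v hv) ^ m := by
  obtain ⟨a, ha⟩ := Projectivization.exists_smul_eq_mk_rep k v hv
  have hf : (f : MvPolynomial (Fin (r + 1)) k).IsHomogeneous m := f.2
  have hl := leadIndex_smul a v _ hv (Projectivization.rep_nonzero _) ha
  have h0 := (leadIndex_spec v hv).1
  have ha0 : (a : k) ≠ 0 := a.ne_zero
  simp only [evalAt, hl, LinearMap.smul_apply, LinearMap.comp_apply, Submodule.subtype_apply,
    AlgHom.toLinearMap_apply, MvPolynomial.aeval_eq_eval, smul_eq_mul]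
  rw [← ha, Units.smul_def, eval_smul_of_homogeneous hf]
  simp only [Pi.smul_apply, smul_eq_mul, mul_pow]
  field_simp

end PointConfig

end

/-!
A form of degree `n` is used only through its values at vectors `p i` representing the points, and
the space of these values is the `n`-th power of the space of values of linear forms
(`formVals`). If the points fail to impose independent conditions on forms of degree `n`, there is
a nonzero relation `c` among the values, and multiplying `c` by the values of a form of degree `d`
gives a relation in degree `n - d` supported away from the zeros of that form
(`mul_mem_relations`). All residual arguments below are instances of this.

A nonzero relation in degree `n` involves at least `n + 2` points (`add_two_le_card_supp`), and if
it involves at most `2n + 1` points they are collinear (`exists_line_of_card_supp_le`). The main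
result `exists_line_or_conic` says that if it involves at most `3n - 1` points, then `n + 2` of them
are collinear or `2n + 2` of them lie on a plane conic. By induction on `n`, applied to the residual
of a hyperplane containing three of the points but not all of them, one gets `n + 1` points on a
line or `2n` points on a plane conic. In the first case the other points are collinear as well; two
lines that meet form a conic, and for two skew lines the relation splits into relations on each of
them (`relation_split_of_disjoint`). In the second case all points are on the conic, so there are
`2n + 2` points on it unless there are so few that they are collinear.

If there is no such hyperplane, then the points are collinear, or they lie in a plane and no three
of them are collinear. In the latter case (`exists_conic_of_no_three_collinear`) a conic through six
of the points is treated by passing to its residual. Otherwise let `h j` be the Hilbert function,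
the dimension of the space of values of forms of degree `j`. Multiplication by `c` shows that
`h a + h b ≤ s` when `a + b = n`, where `s` is the number of points (`finrank_add_finrank_le`). By
induction every relation in degree `j < n` involves at least `3j` points, so `h j ≥ min s (3j - 1)`
by the Singleton bound (`finrank_le_card_sub`). These inequalities, with `h 1 ≥ 3` and
`h 2 ≥ 6`, are contradictory for `n < 5` and otherwise force `s = 3n - 1`,
`h (n - 1) = 3n - 4`, `h (n - 2) ≤ 3n - 7` and `h 3 ≤ 9`. Hence the points lie on a cubic, so that
`h` is concave in degrees at least `2` (`finrank_formVals_concave_of_cubic`). As `h 1 ≥ 3` and the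
increment at `n - 1` is at least `3`, this gives `h (n - 2) ≥ 3n - 6`, a contradiction
(`false_of_relation_of_conics_small`).
-/

open scoped LinearAlgebra.Projectivization

noncomputable section

namespace PointConfig

open Module

/-! ### Forms as functions on a family of vectors -/

section

variable {k E ι : Type*} [Field k] [AddCommGroup E] [Module k E]

/-- The restriction of linear forms on `E` to a family of vectors `p`. -/
def linVals (p : ι → E) : Dual k E →ₗ[k] (ι → k) :=
  LinearMap.pi fun i => Dual.eval k E (p i)

@[simp] theorem linVals_apply (p : ι → E) (l : Dual k E) (i : ι) : linVals p l i = l (p i) := rfl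

/-- The functions on the index set of a family of vectors `p` that are given by forms of degree
`n`, namely the `n`-th power of the space of functions given by linear forms. For `p = id` these
are the forms of degree `n` on `E`, viewed as functions. -/
def formVals (k : Type*) [Field k] [Module k E] (p : ι → E) (n : ℕ) : Submodule k (ι → k) :=
  LinearMap.range (linVals (k := k) p) ^ n

theorem linVals_mem (p : ι → E) (l : Dual k E) : linVals p l ∈ formVals k p 1 := by
  simp [formVals]

theorem mul_mem_formVals {p : ι → E} {a b : ℕ} {f g : ι → k} (hf : f ∈ formVals k p a)
    (hg : g ∈ formVals k p b) : f * g ∈ formVals k p (a + b) := by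
  rw [formVals, pow_add]
  exact Submodule.mul_mem_mul hf hg

theorem pow_mem_formVals (p : ι → E) (l : Dual k E) (n : ℕ) :
    linVals p l ^ n ∈ formVals k p n :=
  Submodule.pow_mem_pow _ (LinearMap.mem_range_self _ l) n

/-- Induction on forms: constants, sums, and products with a linear form. -/
theorem formVals_induction {p : ι → E} {C : ℕ → (ι → k) → Prop}
    (const : ∀ a : k, C 0 (fun _ => a))
    (add : ∀ f g n, C n f → C n g → C n (f + g))
    (mul : ∀ (l : Dual k E) f n, f ∈ formVals k p n → C n f → C (n + 1) (linVals p l * f))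
    {n : ℕ} {f : ι → k} (hf : f ∈ formVals k p n) : C n f := by
  refine Submodule.pow_induction_on_left' _ (C := fun n f _ => C n f) ?_ ?_ ?_ hf
  · exact const
  · exact fun x y i _ _ hx hy => add x y i hx hy
  · rintro _ ⟨l, rfl⟩ n f hf h
    exact mul l f n hf h

/-- Precomposition with a map of index sets, as an algebra homomorphism. -/
def reindexHom {κ : Type*} (k : Type*) [Field k] (σ : κ → ι) : (ι → k) →ₐ[k] (κ → k) :=
  AlgHom.pi fun j => Pi.evalAlgHom k _ (σ j)

@[simp] theorem reindexHom_apply {κ : Type*} (σ : κ → ι) (f : ι → k) (j : κ) :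
    reindexHom k σ f j = f (σ j) := rfl

theorem map_formVals {κ : Type*} (σ : κ → ι) (p : ι → E) (n : ℕ) :
    (formVals k p n).map (reindexHom k σ).toLinearMap = formVals k (p ∘ σ) n := by
  rw [formVals, Submodule.map_pow, formVals]
  congr 1
  rw [← LinearMap.range_comp]
  rfl

theorem mem_formVals_iff {p : ι → E} {n : ℕ} {f : ι → k} :
    f ∈ formVals k p n ↔ ∃ g ∈ formVals k (id : E → E) n, ∀ i, g (p i) = f i := by
  rw [show formVals k p n = _ from (map_formVals p id n).symm, Submodule.mem_map]
  simp only [funext_iff]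
  rfl

theorem comp_mem_formVals {κ : Type*} {σ : κ → ι} {p : ι → E} {n : ℕ} {f : ι → k}
    (hf : f ∈ formVals k p n) : (fun j => f (σ j)) ∈ formVals k (p ∘ σ) n := by
  rw [← map_formVals]
  exact ⟨f, hf, rfl⟩

/-- Forms on the target of a linear map pull back to forms on its source. -/
theorem formVals_comp_linear_le {E' : Type*} [AddCommGroup E'] [Module k E'] (φ : E →ₗ[k] E')
    (p : ι → E) (n : ℕ) : formVals k (fun i => φ (p i)) n ≤ formVals k p n := by
  refine pow_le_pow_left' ?_ n
  rintro _ ⟨l, rfl⟩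
  exact ⟨l ∘ₗ φ, rfl⟩

theorem pullback_mem_formVals {E' : Type*} [AddCommGroup E'] [Module k E'] (φ : E →ₗ[k] E')
    {n : ℕ} {f : E' → k} (hf : f ∈ formVals k (id : E' → E') n) :
    (fun v => f (φ v)) ∈ formVals k (id : E → E) n := by
  have h : (fun v => f (φ v)) ∈ formVals k (id ∘ φ : E → E') n := comp_mem_formVals hf
  exact formVals_comp_linear_le φ id n h

theorem form_apply_smul {n : ℕ} {f : E → k} (hf : f ∈ formVals k (id : E → E) n) (t : k) (v : E) :
    f (t • v) = t ^ n * f v := by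
  refine formVals_induction (C := fun n f => f (t • v) = t ^ n * f v) ?_ ?_ ?_ hf
  · simp
  · intro f g n hf hg
    simp [hf, hg, mul_add]
  · intro l f n _ hf
    simp only [Pi.mul_apply, linVals_apply, id, map_smul, smul_eq_mul, hf]
    ring

theorem form_apply_zero {n : ℕ} (hn : n ≠ 0) {f : E → k} (hf : f ∈ formVals k (id : E → E) n) :
    f 0 = 0 := by
  simpa [hn] using form_apply_smul hf 0 0

/-- Evaluation of polynomials, as an algebra homomorphism to functions. -/
def polyFun (k : Type*) [Field k] (N : ℕ) : MvPolynomial (Fin N) k →ₐ[k] ((Fin N → k) → k) :=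
  AlgHom.pi fun v => MvPolynomial.aeval v

@[simp] theorem polyFun_apply {N : ℕ} (F : MvPolynomial (Fin N) k) (v : Fin N → k) :
    polyFun k N F v = MvPolynomial.eval v F := rfl

theorem map_homogeneousSubmodule (N n : ℕ) :
    (MvPolynomial.homogeneousSubmodule (Fin N) k n).map (polyFun k N).toLinearMap =
      formVals k (id : (Fin N → k) → (Fin N → k)) n := by
  rw [← MvPolynomial.homogeneousSubmodule_one_pow, Submodule.map_pow, formVals]
  congr 1
  rw [MvPolynomial.homogeneousSubmodule_one_eq_span_X, Submodule.map_span]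
  apply le_antisymm
  · rw [Submodule.span_le]
    rintro _ ⟨_, ⟨i, rfl⟩, rfl⟩
    refine ⟨LinearMap.proj i, ?_⟩
    ext v
    simp
  · rintro _ ⟨l, rfl⟩
    have : linVals id l =
        ∑ i, l (Pi.single i 1) • (polyFun k N).toLinearMap (MvPolynomial.X i) := by
      ext v
      simp only [linVals_apply, id, Finset.sum_apply, Pi.smul_apply, AlgHom.toLinearMap_apply,
        polyFun_apply, MvPolynomial.eval_X, smul_eq_mul]
      conv_lhs => rw [← Finset.univ_sum_single v, map_sum]
      refine Finset.sum_congr rfl fun i _ => ?_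
      rw [show (Pi.single i (v i) : Fin N → k) = v i • Pi.single i 1 by
        rw [← Pi.single_smul]; simp, map_smul, smul_eq_mul, mul_comm]
    rw [this]
    exact Submodule.sum_mem _ fun i _ =>
      Submodule.smul_mem _ _ (Submodule.subset_span ⟨_, ⟨i, rfl⟩, rfl⟩)

theorem mem_formVals_iff_exists_poly {N n : ℕ} {f : (Fin N → k) → k} :
    f ∈ formVals k (id : (Fin N → k) → (Fin N → k)) n ↔
      ∃ F : MvPolynomial (Fin N) k, F.IsHomogeneous n ∧ ∀ v, MvPolynomial.eval v F = f v := by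
  rw [← map_homogeneousSubmodule, Submodule.mem_map]
  simp only [funext_iff]
  rfl

/-- Over an infinite field, distinct monomials are linearly independent as functions, so that `M`
monomials of degree `n` give an `M`-dimensional space of forms. -/
theorem exists_injective_to_forms [Infinite k] {N n M : ℕ} (e : Fin M → Fin N →₀ ℕ)
    (he : Function.Injective e) (hd : ∀ i, (e i).degree = n) :
    ∃ Φ : (Fin M → k) →ₗ[k] ((Fin N → k) → k), Function.Injective Φ ∧
      ∀ a, Φ a ∈ formVals k (id : (Fin N → k) → (Fin N → k)) n := by
  have hli : LinearIndependent k fun i => MvPolynomial.monomial (e i) (1 : k) := by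
    have := (MvPolynomial.basisMonomials (Fin N) k).linearIndependent.comp e he
    simpa [Function.comp_def] using this
  refine ⟨(polyFun k N).toLinearMap ∘ₗ Fintype.linearCombination k
    (fun i => MvPolynomial.monomial (e i) (1 : k)), ?_, ?_⟩
  · have h1 : Function.Injective (polyFun k N).toLinearMap := fun F G h =>
      MvPolynomial.funext fun v => congrFun h v
    exact h1.comp (linearIndependent_iff_injective_fintypeLinearCombination.mp hli)
  · intro a
    rw [← map_homogeneousSubmodule]
    refine ⟨_, ?_, rfl⟩
    rw [Fintype.linearCombination_apply]
    refine Submodule.sum_mem _ fun i _ => Submodule.smul_mem _ _ ?_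
    exact MvPolynomial.isHomogeneous_monomial _ (hd i)

theorem exists_injective_to_conics [Infinite k] :
    ∃ Φ : (Fin 6 → k) →ₗ[k] ((Fin 3 → k) → k), Function.Injective Φ ∧
      ∀ a, Φ a ∈ formVals k (id : (Fin 3 → k) → (Fin 3 → k)) 2 := by
  refine exists_injective_to_forms
    (fun i => Finsupp.equivFunOnFinite.symm
      ((![![2, 0, 0], ![0, 2, 0], ![0, 0, 2], ![1, 1, 0], ![1, 0, 1], ![0, 1, 1]] :
        Fin 6 → Fin 3 → ℕ) i)) ?_ ?_
  · exact Finsupp.equivFunOnFinite.symm.injective.comp (by decide)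
  · intro i
    rw [Finsupp.degree_eq_sum]
    simp only [Finsupp.equivFunOnFinite_symm_apply_apply]
    revert i
    decide

theorem exists_injective_to_cubics [Infinite k] :
    ∃ Φ : (Fin 10 → k) →ₗ[k] ((Fin 3 → k) → k), Function.Injective Φ ∧
      ∀ a, Φ a ∈ formVals k (id : (Fin 3 → k) → (Fin 3 → k)) 3 := by
  refine exists_injective_to_forms
    (fun i => Finsupp.equivFunOnFinite.symm
      ((![![3, 0, 0], ![0, 3, 0], ![0, 0, 3], ![2, 1, 0], ![2, 0, 1], ![1, 2, 0], ![0, 2, 1],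
        ![1, 0, 2], ![0, 1, 2], ![1, 1, 1]] : Fin 10 → Fin 3 → ℕ) i)) ?_ ?_
  · exact Finsupp.equivFunOnFinite.symm.injective.comp (by decide)
  · intro i
    rw [Finsupp.degree_eq_sum]
    simp only [Finsupp.equivFunOnFinite_symm_apply_apply]
    revert i
    decide

end

/-! ### Relations among evaluations and their supports -/

section

open scoped Classical

variable {k E ι : Type*} [Field k] [AddCommGroup E] [Module k E] [Fintype ι]

/-- The linear relations among the evaluations of forms of degree `n` at the vectors `p i`: the
orthogonal complement of `formVals k p n` for the dot product. -/
def relations (k : Type*) [Field k] [Module k E] (p : ι → E) (n : ℕ) : Submodule k (ι → k) :=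
  (formVals k p n).dualAnnihilator.comap (dotProductBilin k k)

theorem mem_relations {p : ι → E} {n : ℕ} {c : ι → k} :
    c ∈ relations k p n ↔ ∀ f ∈ formVals k p n, ∑ i, c i * f i = 0 := by
  rw [relations, Submodule.mem_comap, Submodule.mem_dualAnnihilator]
  rfl

/-- Multiplying a relation of degree `a + b` by a form of degree `a` gives a relation of degree
`b`, supported away from the zeros of the form. -/
theorem mul_mem_relations {p : ι → E} {a b : ℕ} {c g : ι → k} (hc : c ∈ relations k p (a + b))
    (hg : g ∈ formVals k p a) : c * g ∈ relations k p b := by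
  rw [mem_relations] at hc ⊢
  intro f hf
  rw [← hc _ (mul_mem_formVals hg hf)]
  exact Finset.sum_congr rfl fun i _ => mul_assoc _ _ _

theorem mul_linVals_mem_relations {p : ι → E} {n : ℕ} {c : ι → k}
    (hc : c ∈ relations k p (n + 1)) (l : Dual k E) : c * linVals p l ∈ relations k p n :=
  mul_mem_relations (by rwa [add_comm] at hc) (linVals_mem p l)

/-- The support of a finite family of scalars. -/
def supp (c : ι → k) : Finset ι := {i | c i ≠ 0}

@[simp] theorem mem_supp {c : ι → k} {i : ι} : i ∈ supp c ↔ c i ≠ 0 := by simp [supp]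

theorem supp_mul_subset (c g : ι → k) : supp (c * g) ⊆ supp c := by
  intro i
  simp only [mem_supp, Pi.mul_apply]
  exact left_ne_zero_of_mul

theorem card_supp_mul (c g : ι → k) :
    (supp (c * g)).card + ((supp c).filter fun i => g i = 0).card = (supp c).card := by
  rw [← Finset.card_filter_add_card_filter_not (s := supp c) (fun i => g i = 0), add_comm]
  congr 2
  ext i
  simp

theorem ne_zero_of_mul_apply {c g : ι → k} {i : ι} (hi : i ∈ supp c) (hg : g i ≠ 0) :
    c * g ≠ 0 := fun h => mul_ne_zero (mem_supp.mp hi) hg (congrFun h i)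

/-- The vectors `p i` represent pairwise distinct points of projective space. -/
structure DistinctPoints (k : Type*) [Field k] [Module k E] {ι : Type*} (p : ι → E) : Prop where
  ne_zero : ∀ i, p i ≠ 0
  notMem : ∀ i j, i ≠ j → p j ∉ Submodule.span k {p i}

theorem DistinctPoints.comp {ι κ : Type*} {p : ι → E} (hp : DistinctPoints k p) {σ : κ → ι}
    (hσ : Function.Injective σ) : DistinctPoints k (p ∘ σ) :=
  ⟨fun _ => hp.ne_zero _, fun _ _ h => hp.notMem _ _ (hσ.ne h)⟩

/-- At most `n + 1` distinct points impose independent conditions on forms of degree `n`: a linear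
form that vanishes at one point of the support of a relation and not at another one lowers both the
degree and the size of the support. -/
theorem add_two_le_card_supp {p : ι → E} (hp : DistinctPoints k p) {n : ℕ} {c : ι → k}
    (hc : c ∈ relations k p n) (h0 : c ≠ 0) : n + 2 ≤ (supp c).card := by
  induction n generalizing c with
  | zero =>
    obtain ⟨i, hi⟩ := Function.ne_iff.mp h0
    by_contra! hlt
    have h1 : supp c = {i} := by
      refine (Finset.eq_of_subset_of_card_le (by simpa using hi) ?_).symm
      simpa using Nat.le_of_lt_succ hlt
    have h2 := mem_relations.mp hc _ (pow_mem_formVals p 0 0)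
    rw [← Finset.sum_subset (Finset.subset_univ (supp c)) (by simp), h1] at h2
    exact hi (by simpa using h2)
  | succ n ih =>
    obtain ⟨i, hi⟩ := Function.ne_iff.mp h0
    have hj : ∃ j ∈ supp c, j ≠ i := by
      by_contra! hall
      obtain ⟨l, hl, -⟩ := Submodule.exists_le_ker_of_notMem (K := k)
        (p := (⊥ : Submodule k E)) (v := p i) (by simpa using hp.ne_zero i)
      have h2 := mem_relations.mp hc _ (pow_mem_formVals p l (n + 1))
      rw [Finset.sum_eq_single i] at h2
      · exact mul_ne_zero hi (pow_ne_zero _ hl) h2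
      · intro j _ hji
        have : c j = 0 := by
          by_contra h
          exact hji (hall j (mem_supp.mpr h))
        simp [this]
      · simp
    obtain ⟨j, hj, hji⟩ := hj
    obtain ⟨l, hl, hker⟩ := Submodule.exists_le_ker_of_notMem (hp.notMem i j hji.symm)
    have h1 := ih (mul_linVals_mem_relations hc l) (ne_zero_of_mul_apply hj hl)
    have h2 := card_supp_mul c (linVals p l)
    have h3 : 0 < ((supp c).filter fun i => linVals p l i = 0).card := by
      refine Finset.card_pos.mpr ⟨i, ?_⟩
      simp only [Finset.mem_filter, mem_supp]
      exact ⟨hi, hker (Submodule.mem_span_singleton_self _)⟩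
    omega

theorem finrank_span_pair_le [FiniteDimensional k E] (v w : E) :
    finrank k (Submodule.span k {v, w}) ≤ 2 := by
  have := finrank_span_finset_le_card (R := k) ({v, w} : Finset E)
  simp only [Finset.coe_insert, Finset.coe_singleton] at this
  exact this.trans Finset.card_le_two

/-- If at most `2n + 1` points carry a relation in degree `n` with nonzero coefficients, then they
are collinear. -/
theorem exists_line_of_card_supp_le [FiniteDimensional k E] {p : ι → E} (hp : DistinctPoints k p)
    {n : ℕ} {c : ι → k} (hc : c ∈ relations k p n) (hcard : (supp c).card ≤ 2 * n + 1) :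
    ∃ W : Submodule k E, finrank k W ≤ 2 ∧ ∀ i ∈ supp c, p i ∈ W := by
  rcases eq_or_ne c 0 with rfl | h0
  · exact ⟨⊥, by simp, by simp⟩
  have hA := add_two_le_card_supp hp hc h0
  induction n generalizing c with
  | zero => omega
  | succ n ih =>
    obtain ⟨i, hi, j, hj, hij⟩ := Finset.one_lt_card.mp (show 1 < (supp c).card by omega)
    by_cases hW0 : ∀ t ∈ supp c, p t ∈ Submodule.span k {p i, p j}
    · exact ⟨_, finrank_span_pair_le _ _, hW0⟩
    push Not at hW0
    -- The residual of a hyperplane through `p i` and `p j` that misses `p t` is on a line `W`.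
    obtain ⟨t, ht, htW⟩ := hW0
    obtain ⟨l, hl, hker⟩ := Submodule.exists_le_ker_of_notMem htW
    have hc' := mul_linVals_mem_relations hc l
    have h0' : c * linVals p l ≠ 0 := ne_zero_of_mul_apply ht hl
    have h2 := card_supp_mul c (linVals p l)
    have h3 : 1 < ((supp c).filter fun i => linVals p l i = 0).card := by
      refine Finset.one_lt_card.mpr ⟨i, ?_, j, ?_, hij⟩ <;> rw [Finset.mem_filter]
      · exact ⟨hi, hker (Submodule.subset_span (by simp))⟩
      · exact ⟨hj, hker (Submodule.subset_span (by simp))⟩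
    have hA' := add_two_le_card_supp hp hc' h0'
    obtain ⟨W, hW, hsub⟩ := ih hc' (by omega) h0' hA'
    refine ⟨W, hW, ?_⟩
    -- A hyperplane through `W` that misses `u` would leave a residual with too few points.
    by_contra! hne
    obtain ⟨u, hu, huW⟩ := hne
    obtain ⟨l', hl', hker'⟩ := Submodule.exists_le_ker_of_notMem huW
    have hA'' := add_two_le_card_supp hp (mul_linVals_mem_relations hc l')
      (ne_zero_of_mul_apply hu hl')
    have h4 := card_supp_mul c (linVals p l')
    have h5 : (supp (c * linVals p l)).card ≤
        ((supp c).filter fun i => linVals p l' i = 0).card := by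
      refine Finset.card_le_card fun i hi => ?_
      rw [Finset.mem_filter]
      exact ⟨supp_mul_subset _ _ hi, hker' (hsub i hi)⟩
    omega

/-- Over an infinite field, some linear form vanishes on a given subspace and at no vector of a finite
family outside it. -/
theorem exists_dual_separating [Infinite k] (W : Submodule k E) (p : ι → E) :
    ∃ l : Dual k E, W ≤ LinearMap.ker l ∧ ∀ i, p i ∉ W → l (p i) ≠ 0 := by
  obtain ⟨f, hf⟩ := Module.exists_dual_forall_apply_ne_zero (K := k)
    (fun i : {i // p i ∉ W} => W.mkQ (p i)) fun i => by simpa using i.2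
  refine ⟨f ∘ₗ W.mkQ, fun w hw => ?_, fun i hi => hf ⟨i, hi⟩⟩
  have : W.mkQ w = 0 := by simpa using hw
  simp [LinearMap.mem_ker, this]

/-- Restricting a relation to a set of indices containing its support. -/
theorem relations_comp_subtype {p : ι → E} {n : ℕ} {c : ι → k} (hc : c ∈ relations k p n)
    (s : Finset ι) (hs : supp c ⊆ s) :
    (fun i : s => c i) ∈ relations k (fun i : s => p i) n := by
  rw [mem_relations] at hc ⊢
  intro f hf
  obtain ⟨g, hg, hgf⟩ := mem_formVals_iff.mp hf
  have h := hc (fun i => g (p i)) (mem_formVals_iff.mpr ⟨g, hg, fun _ => rfl⟩)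
  rw [← Finset.sum_subset (Finset.subset_univ s), ← Finset.sum_coe_sort] at h
  · simpa only [← hgf] using h
  · intro i _ hi
    have : c i = 0 := by
      by_contra h
      exact hi (hs (mem_supp.mpr h))
    simp [this]

theorem finrank_relations_add (p : ι → E) (n : ℕ) :
    finrank k (relations k p n) + finrank k (formVals k p n) = Fintype.card ι := by
  have h : relations k p n =
      (formVals k p n).dualAnnihilator.comap (dotProductEquiv k ι : (ι → k) →ₗ[k] _) := rfl
  rw [h, Submodule.comap_equiv_eq_map_symm, LinearEquiv.finrank_map_eq, add_comm,
    Subspace.finrank_add_finrank_dualAnnihilator_eq, finrank_fintype_fun_eq_card]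

/-- A relation of degree `a + b` without zero coefficients makes the Hilbert functions in degrees
`a` and `b` add up to at most the number of points. -/
theorem finrank_add_finrank_le {p : ι → E} {a b : ℕ} {c : ι → k}
    (hc : c ∈ relations k p (a + b)) (h0 : ∀ i, c i ≠ 0) :
    finrank k (formVals k p a) + finrank k (formVals k p b) ≤ Fintype.card ι := by
  rw [← finrank_relations_add (k := k) p b]
  gcongr
  have hinj : Function.Injective (LinearMap.mulLeft k c) := by
    intro f g h
    ext i
    exact mul_left_cancel₀ (h0 i) (congrFun h i)
  rw [(Submodule.equivMapOfInjective _ hinj (formVals k p a)).finrank_eq]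
  refine Submodule.finrank_mono ?_
  rintro _ ⟨g, hg, rfl⟩
  exact mul_mem_relations hc hg

/-- The Singleton bound: a space of vectors in which every nonzero vector has more than `d`
nonzero entries has codimension at least `d`. -/
theorem finrank_le_card_sub (C : Submodule k (ι → k)) (d : ℕ)
    (hC : ∀ c ∈ C, c ≠ 0 → d < (supp c).card) : finrank k C ≤ Fintype.card ι - d := by
  rcases le_total d (Fintype.card ι) with hd | hd
  · obtain ⟨T, -, hT⟩ := Finset.exists_subset_card_eq (s := (Finset.univ : Finset ι))
      (n := d) (by simpa using hd)
    let res : C →ₗ[k] ((Tᶜ : Finset ι) → k) :=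
      LinearMap.funLeft k k (fun i : (Tᶜ : Finset ι) => (i : ι)) ∘ₗ C.subtype
    have hinj : Function.Injective res := by
      rw [← LinearMap.ker_eq_bot, LinearMap.ker_eq_bot']
      rintro ⟨c, hc⟩ h
      by_contra hne
      have h1 := hC c hc (fun h => hne (by simp [h]))
      have h2 : supp c ⊆ T := by
        intro i hi
        by_contra hiT
        exact mem_supp.mp hi (congrFun h ⟨i, by simpa using hiT⟩)
      have := Finset.card_le_card h2
      omega
    refine (LinearMap.finrank_le_finrank_of_injective hinj).trans ?_
    simp [hT]
  · have : C = ⊥ := by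
      rw [Submodule.eq_bot_iff]
      intro c hc
      by_contra hne
      have h1 := hC c hc hne
      have h2 := Finset.card_le_univ (supp c)
      omega
    rw [this, finrank_bot]
    exact Nat.zero_le _

end

/-! ### Concavity of the Hilbert function on a plane cubic -/

section

open scoped Classical

variable {k E ι : Type*} [Field k] [AddCommGroup E] [Module k E] [Fintype ι]

/-- If the linear forms are spanned by `D` and `y`, then every form is a power of `y`, up to a scalar,
modulo the ideal generated by `D`. -/
theorem pow_succ_le_mul_sup_span {A : Type*} [CommRing A] [Algebra k A] {S D : Submodule k A}
    {y : A} (h : S = D ⊔ Submodule.span k {y}) (n : ℕ) :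
    S ^ (n + 1) ≤ D * S ^ n ⊔ Submodule.span k {y ^ (n + 1)} := by
  induction n with
  | zero => simp [h]
  | succ n ih =>
    have hy : Submodule.span k {y} ≤ S := h ▸ le_sup_right
    calc S ^ (n + 1 + 1) = (D ⊔ Submodule.span k {y}) * S ^ (n + 1) := by rw [pow_succ', ← h]
      _ = D * S ^ (n + 1) ⊔ Submodule.span k {y} * S ^ (n + 1) := Submodule.sup_mul _ _ _
      _ ≤ D * S ^ (n + 1) ⊔
          Submodule.span k {y} * (D * S ^ n ⊔ Submodule.span k {y ^ (n + 1)}) := by gcongr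
      _ = D * S ^ (n + 1) ⊔ (D * (Submodule.span k {y} * S ^ n) ⊔
          Submodule.span k {y ^ (n + 1 + 1)}) := by
        rw [Submodule.mul_sup, mul_left_comm, Submodule.span_mul_span, Set.singleton_mul_singleton,
          pow_succ' y (n + 1)]
      _ ≤ D * S ^ (n + 1) ⊔ (D * (S * S ^ n) ⊔ Submodule.span k {y ^ (n + 1 + 1)}) := by gcongr
      _ = D * S ^ (n + 1) ⊔ Submodule.span k {y ^ (n + 1 + 1)} := by
        rw [← pow_succ', ← sup_assoc, sup_idem]

/-- If the forms of degree `m + 2` are generated over those of degree `m + 1` by two linear forms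
`x` and `z`, of which `z` has no zeros, then the Hilbert function is concave at `m + 1`: the
relations between `x` and `z` contain a copy of the forms of degree `m`. -/
theorem finrank_formVals_concave {p : ι → E} {x z : Dual k E} (hz : ∀ i, z (p i) ≠ 0) {m : ℕ}
    (h : formVals k p (m + 2) ≤
      Submodule.span k {linVals p x, linVals p z} * formVals k p (m + 1)) :
    finrank k (formVals k p (m + 2)) + finrank k (formVals k p m) ≤
      2 * finrank k (formVals k p (m + 1)) := by
  let V := formVals k p (m + 1)
  let Ψ : V × V →ₗ[k] (ι → k) :=
    (LinearMap.mulLeft k (linVals p x) ∘ₗ V.subtype).coprod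
      (LinearMap.mulLeft k (linVals p z) ∘ₗ V.subtype)
  have hΨ : ∀ f g : V, Ψ (f, g) = linVals p x * f + linVals p z * g := fun f g => rfl
  have h1 := LinearMap.finrank_range_add_finrank_ker Ψ
  have h2 : formVals k p (m + 2) ≤ LinearMap.range Ψ := by
    refine h.trans (Submodule.mul_le.mpr fun a ha f hf => ?_)
    obtain ⟨s, t, rfl⟩ := Submodule.mem_span_pair.mp ha
    refine ⟨(s • ⟨f, hf⟩, t • ⟨f, hf⟩), ?_⟩
    rw [hΨ]
    simp [add_mul]
  have hmul : ∀ (l : Dual k E) {u : ι → k}, u ∈ formVals k p m → linVals p l * u ∈ V := by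
    intro l u hu
    have := mul_mem_formVals (linVals_mem p l) hu
    rwa [add_comm] at this
  have h3 : finrank k (formVals k p m) ≤ finrank k (LinearMap.ker Ψ) := by
    let θ : formVals k p m →ₗ[k] V × V :=
      (((LinearMap.mulLeft k (linVals p z)).restrict (fun u hu => hmul z hu)).prod
        (-((LinearMap.mulLeft k (linVals p x)).restrict (fun u hu => hmul x hu))))
    have hθ : ∀ u, θ u ∈ LinearMap.ker Ψ := by
      intro u
      rw [LinearMap.mem_ker]
      change linVals p x * (linVals p z * (u : ι → k)) +
        linVals p z * -(linVals p x * (u : ι → k)) = 0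
      ring
    refine LinearMap.finrank_le_finrank_of_injective (f := θ.codRestrict _ hθ) ?_
    intro u v huv
    have h4 : linVals p z * (u : ι → k) = linVals p z * (v : ι → k) :=
      congrArg (fun w : LinearMap.ker Ψ => ((w : V × V).1 : ι → k)) huv
    ext i
    exact mul_left_cancel₀ (hz i) (congrFun h4 i)
  have h4 := Submodule.finrank_mono h2
  rw [finrank_prod] at h1
  change _ ≤ 2 * finrank k V
  omega

theorem exists_pair_of_mem_finrank_two {F : Type*} [AddCommGroup F] [Module k F]
    [FiniteDimensional k F] {N : Submodule k F} (hN : finrank k N = 2) {z : F} (hz : z ∈ N)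
    (hz0 : z ≠ 0) : ∃ x, N = Submodule.span k {x, z} := by
  have h1 : ¬ N ≤ Submodule.span k {z} := by
    intro h
    have := Submodule.finrank_mono h
    rw [finrank_span_singleton hz0] at this
    omega
  obtain ⟨x, hx, hxz⟩ := SetLike.not_le_iff_exists.mp h1
  refine ⟨x, (Submodule.eq_of_le_of_finrank_le ?_ ?_).symm⟩
  · rw [Submodule.span_le]
    rintro _ (rfl | rfl)
    exacts [hx, hz]
  · have hli : LinearIndependent k ![x, z] := by
      rw [LinearIndependent.pair_symm_iff, LinearIndependent.pair_iff' hz0]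
      rintro a rfl
      exact hxz (Submodule.smul_mem _ _ (Submodule.mem_span_singleton_self _))
    have := finrank_span_eq_card hli
    rw [Matrix.range_cons_cons_empty] at this
    simp [hN, this]

theorem range_linVals_eq {κ : Type*} {x z y : Dual k E}
    (h : (⊤ : Submodule k (Dual k E)) = Submodule.span k {x, z} ⊔ Submodule.span k {y})
    (q : κ → E) : LinearMap.range (linVals (k := k) q) =
      Submodule.span k {linVals q x, linVals q z} ⊔ Submodule.span k {linVals q y} := by
  rw [LinearMap.range_eq_map, h, Submodule.map_sup, Submodule.map_span, Submodule.map_span,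
    Set.image_pair, Set.image_singleton]

/-- The Hilbert function of points on a plane cubic `G` is concave in degrees at least `2`. With
`x` and `z` spanning the linear forms that vanish at a point `Q` off the cubic, `G` expresses the
cube of a third coordinate through multiples of `x` and `z`. -/
theorem finrank_formVals_concave_of_cubic [Infinite k] [FiniteDimensional k E] [Nonempty ι]
    (hE : finrank k E = 3) {p : ι → E}
    (hp : ∀ i, p i ≠ 0) {G : E → k} (hG : G ∈ formVals k (id : E → E) 3) (hG0 : G ≠ 0)
    (hGp : ∀ i, G (p i) = 0) (j : ℕ) :
    finrank k (formVals k p (j + 3)) + finrank k (formVals k p (j + 1)) ≤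
      2 * finrank k (formVals k p (j + 2)) := by
  obtain ⟨Q, hQ⟩ := Function.ne_iff.mp hG0
  have hQ0 : Q ≠ 0 := by
    rintro rfl
    exact hQ (form_apply_zero (by norm_num) hG)
  have hpQ : ∀ i, p i ∉ Submodule.span k {Q} := by
    intro i hi
    obtain ⟨t, ht⟩ := Submodule.mem_span_singleton.mp hi
    have h1 := form_apply_smul hG t Q
    rw [ht, hGp] at h1
    have ht0 : t ≠ 0 := by
      rintro rfl
      exact hp i (by simpa using ht.symm)
    exact mul_ne_zero (pow_ne_zero 3 ht0) hQ h1.symm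
  obtain ⟨z, hzQ, hz⟩ := exists_dual_separating (k := k) (Submodule.span k {Q}) p
  replace hz := fun i => hz i (hpQ i)
  let N : Submodule k (Dual k E) := (Submodule.span k {Q}).dualAnnihilator
  have hN : finrank k N = 2 := by
    have := Subspace.finrank_add_finrank_dualAnnihilator_eq (Submodule.span k {Q})
    rw [finrank_span_singleton hQ0, hE] at this
    change 1 + finrank k N = 3 at this
    omega
  have hzN : z ∈ N := (Submodule.mem_dualAnnihilator z).mpr fun w hw => hzQ hw
  have hz0 : z ≠ 0 := by
    rintro rfl
    obtain ⟨i⟩ := ‹Nonempty ι›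
    exact hz i rfl
  obtain ⟨x, hx⟩ := exists_pair_of_mem_finrank_two hN hzN hz0
  obtain ⟨y', hy', -⟩ := Submodule.exists_le_ker_of_notMem (K := k)
    (p := (⊥ : Submodule k E)) (v := Q) (by simpa using hQ0)
  obtain ⟨y, hy⟩ : ∃ y : Dual k E, y Q = 1 := ⟨(y' Q)⁻¹ • y', by simp [hy']⟩
  -- The linear forms are spanned by `x`, `z` and `y`.
  have htop : (⊤ : Submodule k (Dual k E)) = Submodule.span k {x, z} ⊔ Submodule.span k {y} := by
    rw [← hx]
    refine (eq_top_iff.mpr fun l _ => ?_).symm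
    refine Submodule.mem_sup.mpr ⟨l - l Q • y, ?_, l Q • y,
      Submodule.smul_mem _ _ (Submodule.mem_span_singleton_self _), by simp⟩
    refine (Submodule.mem_dualAnnihilator _).mpr fun w hw => ?_
    obtain ⟨t, rfl⟩ := Submodule.mem_span_singleton.mp hw
    simp [hy]
  -- Comparing values at `Q` shows that the coefficient of `y ^ 3` in `G` is not zero.
  have hy3 : linVals p y ^ 3 ∈
      Submodule.span k {linVals p x, linVals p z} * formVals k p 2 := by
    have h1 : G ∈ _ := pow_succ_le_mul_sup_span (range_linVals_eq htop (id : E → E)) 2 hG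
    obtain ⟨d, hd, w, hw, hdw⟩ := Submodule.mem_sup.mp h1
    obtain ⟨a, rfl⟩ := Submodule.mem_span_singleton.mp hw
    have hdQ : d Q = 0 := by
      refine Submodule.mul_induction_on hd ?_ ?_
      · intro f hf g _
        obtain ⟨s, t, rfl⟩ := Submodule.mem_span_pair.mp hf
        have hxN : x ∈ N := hx ▸ Submodule.subset_span (by simp)
        have e1 : x Q = 0 :=
          (Submodule.mem_dualAnnihilator x).mp hxN Q (Submodule.mem_span_singleton_self _)
        have e2 : z Q = 0 := hzQ (Submodule.mem_span_singleton_self _)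
        simp [e1, e2]
      · intro f g hf hg
        simp [hf, hg]
    have ha : a ≠ 0 := by
      rintro rfl
      apply hQ
      rw [← hdw]
      simp [hdQ]
    have hd' : reindexHom k p d ∈
        Submodule.span k {linVals p x, linVals p z} * formVals k p 2 := by
      have : reindexHom k p d ∈ (Submodule.span k {linVals id x, linVals id z} *
        formVals k (id : E → E) 2).map (reindexHom k p).toLinearMap := ⟨d, hd, rfl⟩
      rw [Submodule.map_mul, map_formVals, Submodule.map_span, Set.image_pair] at this
      exact this
    have h2 : linVals p y ^ 3 = -(a⁻¹) • reindexHom k p d := by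
      ext i
      have h3 := congrFun hdw (p i)
      rw [hGp] at h3
      have h4 : d (p i) + a * y (p i) ^ 3 = 0 := h3
      simp only [Pi.pow_apply, linVals_apply, Pi.smul_apply, reindexHom_apply, smul_eq_mul]
      field_simp
      linear_combination h4
    rw [h2]
    exact Submodule.smul_mem _ _ hd'
  have h3 : formVals k p 3 ≤
      Submodule.span k {linVals p x, linVals p z} * formVals k p 2 := by
    refine (pow_succ_le_mul_sup_span (range_linVals_eq htop p) 2).trans (sup_le le_rfl ?_)
    rwa [Submodule.span_singleton_le_iff_mem]
  refine finrank_formVals_concave (m := j + 1) (x := x) hz ?_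
  calc formVals k p (j + 3) = formVals k p 3 * formVals k p j := by
        rw [formVals, formVals, formVals, ← pow_add, add_comm]
    _ ≤ Submodule.span k {linVals p x, linVals p z} * formVals k p 2 * formVals k p j :=
        mul_le_mul' h3 le_rfl
    _ = Submodule.span k {linVals p x, linVals p z} * formVals k p (j + 2) := by
        rw [mul_assoc, formVals, formVals, formVals, ← pow_add, add_comm 2]

end

/-! ### Plane points with no three collinear -/

section

open scoped Classical

variable {k ι : Type*} [Field k] [Fintype ι]

/-- The increments of a concave sequence are at least the last one, here at least `3`. -/
theorem three_mul_le_of_concave {g : ℕ → ℕ} (hg : ∀ j, g (j + 2) + g j ≤ 2 * g (j + 1)) (m : ℕ)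
    (hm : g m + 3 ≤ g (m + 1)) : g 0 + 3 * m ≤ g m := by
  induction m with
  | zero => simp
  | succ m ih =>
    have h1 : g (m + 1 + 1) + g m ≤ 2 * g (m + 1) := hg m
    have h2 := ih (by omega)
    omega

/-- If a space of ternary forms has dimension more than its space of values at the points `q i`,
then some nonzero form in it vanishes at all of them. -/
theorem exists_form_vanishing {q : ι → (Fin 3 → k)} {n M : ℕ}
    {Φ : (Fin M → k) →ₗ[k] ((Fin 3 → k) → k)} (hΦ : Function.Injective Φ)
    (hmem : ∀ a, Φ a ∈ formVals k (id : (Fin 3 → k) → (Fin 3 → k)) n)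
    (h : finrank k (formVals k q n) < M) :
    ∃ F ∈ formVals k (id : (Fin 3 → k) → (Fin 3 → k)) n, F ≠ 0 ∧ ∀ i, F (q i) = 0 := by
  let Ψ : (Fin M → k) →ₗ[k] formVals k q n :=
    ((reindexHom k q).toLinearMap ∘ₗ Φ).codRestrict _ fun a =>
      mem_formVals_iff.mpr ⟨Φ a, hmem a, fun _ => rfl⟩
  have hker : ¬ Function.Injective Ψ := by
    intro hinj
    have := LinearMap.finrank_le_finrank_of_injective hinj
    rw [finrank_fin_fun] at this
    omega
  rw [← LinearMap.ker_eq_bot, Submodule.eq_bot_iff] at hker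
  push Not at hker
  obtain ⟨a, ha, ha0⟩ := hker
  refine ⟨Φ a, hmem a, fun h0 => ha0 (hΦ (h0.trans (map_zero Φ).symm)), fun i => ?_⟩
  exact congrFun (congrArg Subtype.val (LinearMap.mem_ker.mp ha)) i

/-- Plane points, no three collinear and no six on a conic, at most `3n - 1` in number, carry no
relation in degree `n` without zero coefficients, provided that relations in lower degrees `j`
involve at least `3j` points. Duality bounds the Hilbert function from above, the lower degrees
bound it from below; this forces the points onto a cubic, where concavity gives a contradiction. -/
theorem false_of_relation_of_conics_small [Infinite k] {q : ι → (Fin 3 → k)}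
    (hq : ∀ i, q i ≠ 0)
    (hgen : ∀ W : Submodule k (Fin 3 → k), finrank k W ≤ 2 →
      (Finset.univ.filter fun i => q i ∈ W).card ≤ 2)
    {n : ℕ} {c : ι → k} (hc : c ∈ relations k q n) (h0 : ∀ i, c i ≠ 0)
    (hcard : Fintype.card ι + 1 ≤ 3 * n) (h6 : 6 ≤ Fintype.card ι)
    (hconic : ∀ F ∈ formVals k (id : (Fin 3 → k) → (Fin 3 → k)) 2, F ≠ 0 →
      (Finset.univ.filter fun i => F (q i) = 0).card ≤ 5)
    (hlow : ∀ j < n, ∀ c' ∈ relations k q j, c' ≠ 0 → 3 * j - 1 < (supp c').card) : False := by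
  have hsym : ∀ a b, a + b = n → finrank k (formVals k q a) + finrank k (formVals k q b) ≤
      Fintype.card ι := by
    rintro a b rfl
    exact finrank_add_finrank_le hc h0
  have hlower : ∀ j < n, Fintype.card ι - (Fintype.card ι - (3 * j - 1)) ≤
      finrank k (formVals k q j) := by
    intro j hj
    have h1 := finrank_relations_add (k := k) q j
    have h2 := finrank_le_card_sub (relations k q j) (3 * j - 1) (hlow j hj)
    omega
  have hh1 : 3 ≤ finrank k (formVals k q 1) := by
    have hinj : Function.Injective
        ((linVals (k := k) q).codRestrict (formVals k q 1) (linVals_mem q)) := by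
      rw [← LinearMap.ker_eq_bot, LinearMap.ker_eq_bot']
      intro l hl
      by_contra hl0
      have h2 : finrank k (LinearMap.ker l) ≤ 2 := by
        have h3 := Module.Dual.finrank_ker_add_one_of_ne_zero hl0
        rw [finrank_fin_fun] at h3
        omega
      have h4 := hgen _ h2
      rw [Finset.filter_true_of_mem fun i _ => ?_, Finset.card_univ] at h4
      · omega
      · exact LinearMap.mem_ker.mpr (congrFun (congrArg Subtype.val hl) i)
    have := LinearMap.finrank_le_finrank_of_injective hinj
    rwa [Subspace.dual_finrank_eq, finrank_fin_fun] at this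
  have hh2 : 6 ≤ finrank k (formVals k q 2) := by
    by_contra! hlt
    obtain ⟨Φ, hΦ, hmem⟩ := exists_injective_to_conics (k := k)
    obtain ⟨F, hF, hF0, hFq⟩ := exists_form_vanishing hΦ hmem hlt
    have := hconic F hF hF0
    rw [Finset.filter_true_of_mem fun i _ => hFq i, Finset.card_univ] at this
    omega
  have hn : 5 ≤ n := by
    by_contra! hlt
    have h1 : n = 3 ∨ n = 4 := by omega
    rcases h1 with rfl | rfl
    · have := hsym 1 2 rfl
      omega
    · have := hsym 2 2 rfl
      omega
  have s1 := hsym 1 (n - 1) (by omega)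
  have s2 := hsym 2 (n - 2) (by omega)
  have s3 := hsym 3 (n - 3) (by omega)
  have l1 := hlower (n - 1) (by omega)
  have l3 := hlower (n - 3) (by omega)
  -- `h 3 ≤ s - h (n - 3) ≤ 9` is less than the dimension of the space of cubics.
  obtain ⟨Φ, hΦ, hmem⟩ := exists_injective_to_cubics (k := k)
  obtain ⟨G, hG, hG0, hGq⟩ := exists_form_vanishing hΦ hmem (q := q) (by omega)
  have : Nonempty ι := Fintype.card_pos_iff.mp (by omega)
  have hconc := finrank_formVals_concave_of_cubic (finrank_fin_fun k) hq hG hG0 hGq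
  have h3 := three_mul_le_of_concave (g := fun j => finrank k (formVals k q (j + 1))) hconc (n - 3)
  rw [show n - 3 + 1 + 1 = n - 1 by omega, show n - 3 + 1 = n - 2 by omega, zero_add] at h3
  omega

/-- At most `3n - 1` points in a plane, no three of them collinear, that carry a relation in degree
`n` have `2n + 2` points on a conic. -/
theorem exists_conic_of_no_three_collinear [Infinite k] {q : ι → (Fin 3 → k)}
    (hq : DistinctPoints k q)
    (hgen : ∀ W : Submodule k (Fin 3 → k), finrank k W ≤ 2 →
      (Finset.univ.filter fun i => q i ∈ W).card ≤ 2)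
    {n : ℕ} {c : ι → k} (hc : c ∈ relations k q n) (h0 : c ≠ 0)
    (hcard : (supp c).card + 1 ≤ 3 * n) :
    ∃ F ∈ formVals k (id : (Fin 3 → k) → (Fin 3 → k)) 2, F ≠ 0 ∧
      2 * n + 2 ≤ ((supp c).filter fun i => F (q i) = 0).card := by
  induction n using Nat.strong_induction_on generalizing ι with
  | _ n ih =>
  have hline : ∀ (m : ℕ) (c' : ι → k), c' ∈ relations k q m → c' ≠ 0 → 1 ≤ m →
      2 * m + 2 ≤ (supp c').card := by
    intro m c' hc' h0' hm
    by_contra! hlt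
    obtain ⟨W, hW, hsub⟩ := exists_line_of_card_supp_le hq hc' (by omega)
    have h1 := add_two_le_card_supp hq hc' h0'
    have h2 : (supp c').card ≤ (Finset.univ.filter fun i => q i ∈ W).card :=
      Finset.card_le_card fun i hi => by simpa using hsub i hi
    have h3 := hgen W hW
    omega
  have hsupp := hline n c hc h0 (by omega)
  have hval : ∀ {F}, F ∈ formVals k (id : (Fin 3 → k) → (Fin 3 → k)) 2 →
      c * (fun i => F (q i)) ∈ relations k q (n - 2) := by
    intro F hF
    refine mul_mem_relations (a := 2) ?_ (mem_formVals_iff.mpr ⟨F, hF, fun _ => rfl⟩)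
    rwa [show 2 + (n - 2) = n by omega]
  have hdone : ∀ {F}, F ∈ formVals k (id : (Fin 3 → k) → (Fin 3 → k)) 2 → F ≠ 0 →
      c * (fun i => F (q i)) = 0 → ∃ F ∈ formVals k (id : (Fin 3 → k) → (Fin 3 → k)) 2, F ≠ 0 ∧
      2 * n + 2 ≤ ((supp c).filter fun i => F (q i) = 0).card := by
    intro F hF hF0 hz
    refine ⟨F, hF, hF0, ?_⟩
    have h1 := card_supp_mul c (fun i => F (q i))
    rw [hz] at h1
    simp only [supp, Pi.zero_apply, ne_eq, not_true_eq_false, Finset.filter_false,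
      Finset.card_empty] at h1 hsupp ⊢
    omega
  by_cases hbig : ∃ F ∈ formVals k (id : (Fin 3 → k) → (Fin 3 → k)) 2, F ≠ 0 ∧
      6 ≤ ((supp c).filter fun i => F (q i) = 0).card
  · -- The residual of the conic `F` has at most `3n - 7` points, so it contributes `2n - 2` points on
    -- a conic `F'`, whose residual has at most `n + 1` points.
    obtain ⟨F, hF, hF0, hF6⟩ := hbig
    by_cases hz : c * (fun i => F (q i)) = 0
    · exact hdone hF hF0 hz
    have h1 := card_supp_mul c (fun i => F (q i))
    obtain ⟨F', hF', hF'0, hcount⟩ := ih (n - 2) (by omega) hq hgen (hval hF) hz (by omega)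
    by_cases hz' : c * (fun i => F' (q i)) = 0
    · exact hdone hF' hF'0 hz'
    have h2 := card_supp_mul c (fun i => F' (q i))
    have h3 := Finset.card_le_card
      (Finset.filter_subset_filter (fun i => F' (q i) = 0) (supp_mul_subset c (fun i => F (q i))))
    have h4 := Finset.card_filter_le (supp (c * fun i => F (q i))) (fun i => F' (q i) = 0)
    have h5 := hline (n - 2) _ (hval hF') hz' (by omega)
    omega
  · push Not at hbig
    exfalso
    -- Discard the points with coefficient zero.
    have hcc := relations_comp_subtype hc (supp c) subset_rfl
    have hqq : DistinctPoints k (fun i : supp c => q i) := hq.comp Subtype.val_injective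
    have hcardle : ∀ (P : ι → Prop),
        (Finset.univ.filter fun i : supp c => P i).card = ((supp c).filter P).card := by
      intro P
      rw [← Finset.card_map (Function.Embedding.subtype _)]
      congr 1
      ext i
      simp [and_comm]
    have hgg : ∀ W : Submodule k (Fin 3 → k), finrank k W ≤ 2 →
        (Finset.univ.filter fun i : supp c => q i ∈ W).card ≤ 2 := by
      intro W hW
      rw [hcardle fun i => q i ∈ W]
      exact (Finset.card_le_card (Finset.filter_subset_filter _ (Finset.subset_univ _))).trans
        (hgen W hW)
    have hcon : ∀ F ∈ formVals k (id : (Fin 3 → k) → (Fin 3 → k)) 2, F ≠ 0 →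
        (Finset.univ.filter fun i : supp c => F (q i) = 0).card ≤ 5 := by
      intro F hF hF0
      rw [hcardle fun i => F (q i) = 0]
      exact Nat.le_of_lt_succ (hbig F hF hF0)
    refine false_of_relation_of_conics_small hqq.ne_zero hgg hcc
      (fun i => mem_supp.mp i.2) (by rwa [Fintype.card_coe]) (by rw [Fintype.card_coe]; omega) hcon ?_
    intro j hj c' hc' h0'
    by_contra! hle
    have h1 := add_two_le_card_supp hqq hc' h0'
    obtain ⟨F, hF, hF0, hcount⟩ := ih j hj hqq hgg hc' h0' (by omega)
    have h2 := Finset.card_filter_le (supp c') (fun i => F (q i) = 0)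
    have h3 := Finset.card_le_card
      (Finset.filter_subset_filter (fun i : supp c => F (q i) = 0) (Finset.subset_univ (supp c')))
    have h4 := hcon F hF hF0
    omega

end

/-! ### Points in a space of any dimension -/

section

open scoped Classical

variable {k E ι : Type*} [Field k] [AddCommGroup E] [Module k E] [Fintype ι]

theorem exists_le_finrank_eq [FiniteDimensional k E] (W : Submodule k E) {d : ℕ}
    (hW : finrank k W ≤ d) (hd : d ≤ finrank k E) :
    ∃ W' : Submodule k E, W ≤ W' ∧ finrank k W' = d := by
  induction d, hW using Nat.le_induction with
  | base => exact ⟨W, le_rfl, rfl⟩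
  | succ d _ ih =>
    obtain ⟨W', hle, hW'⟩ := ih (by omega)
    obtain ⟨v, hv⟩ : ∃ v, v ∉ W' := by
      by_contra! hall
      rw [(Submodule.eq_top_iff').mpr hall, finrank_top] at hW'
      omega
    exact ⟨W' ⊔ Submodule.span k {v}, hle.trans le_sup_left,
      by rw [Submodule.finrank_sup_span_singleton hv, hW']⟩

theorem exists_plane_embedding [FiniteDimensional k E] (hE : 3 ≤ finrank k E)
    (W : Submodule k E) (hW : finrank k W ≤ 3) :
    ∃ φ : (Fin 3 → k) →ₗ[k] E, Function.Injective φ ∧ W ≤ LinearMap.range φ := by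
  obtain ⟨W', hWW', hW'⟩ := exists_le_finrank_eq W hW hE
  let e : (Fin 3 → k) ≃ₗ[k] W' := LinearEquiv.ofFinrankEq _ _ (by rw [finrank_fin_fun, hW'])
  refine ⟨W'.subtype ∘ₗ e, W'.injective_subtype.comp e.injective, fun w hw => ?_⟩
  exact ⟨e.symm ⟨w, hWW' hw⟩, by simp⟩

/-- Two lines with a common point lie on a plane conic. -/
theorem exists_conic_of_two_lines [Infinite k] [FiniteDimensional k E] (hE : 3 ≤ finrank k E)
    {W W' : Submodule k E} (hW : finrank k W ≤ 2) (hW' : finrank k W' ≤ 2) (hne : W ⊓ W' ≠ ⊥) :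
    ∃ φ : (Fin 3 → k) →ₗ[k] E, Function.Injective φ ∧
      ∃ F ∈ formVals k (id : (Fin 3 → k) → (Fin 3 → k)) 2, F ≠ 0 ∧
        ∀ w, w ∈ W ∨ w ∈ W' → ∃ v, φ v = w ∧ F v = 0 := by
  have h1 := Submodule.finrank_sup_add_finrank_inf_eq W W'
  have h2 : 0 < finrank k (W ⊓ W' : Submodule k E) := by
    rw [Nat.pos_iff_ne_zero, ne_eq, Submodule.finrank_eq_zero]
    exact hne
  obtain ⟨φ, hφ, hle⟩ := exists_plane_embedding hE (W ⊔ W') (by omega)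
  have key : ∀ U : Submodule k E, finrank k U ≤ 2 →
      ∃ l : Dual k (Fin 3 → k), l ≠ 0 ∧ ∀ v, φ v ∈ U → l v = 0 := by
    intro U hU
    have h3 : U.comap φ < ⊤ := by
      refine lt_top_iff_ne_top.mpr fun htop => ?_
      have h4 : finrank k (U.comap φ) ≤ finrank k U :=
        LinearMap.finrank_le_finrank_of_injective
          (f := (φ ∘ₗ (U.comap φ).subtype).codRestrict U fun v => v.2)
          fun v w h => Subtype.ext (hφ (congrArg Subtype.val h))
      rw [htop, finrank_top, finrank_fin_fun] at h4
      omega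
    obtain ⟨l, hl, hker⟩ := Submodule.exists_le_ker_of_lt_top _ h3
    exact ⟨l, hl, fun v hv => hker hv⟩
  obtain ⟨l, hl, hlW⟩ := key W hW
  obtain ⟨l', hl', hlW'⟩ := key W' hW'
  refine ⟨φ, hφ, linVals id l * linVals id l',
    mul_mem_formVals (linVals_mem _ l) (linVals_mem _ l'), ?_, ?_⟩
  · obtain ⟨v, hv⟩ := Module.Dual.exists_forall_ne_zero_of_forall_exists
      (fun b : Bool => if b then l else l') fun b => by
        cases b
        · simpa using DFunLike.ne_iff.mp hl'
        · simpa using DFunLike.ne_iff.mp hl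
    exact fun h => mul_ne_zero (hv true) (hv false) (congrFun h v)
  · intro w hw
    obtain ⟨v, rfl⟩ := hle (hw.elim (fun h => Submodule.mem_sup_left h)
      fun h => Submodule.mem_sup_right h)
    refine ⟨v, rfl, ?_⟩
    rcases hw with hw | hw
    · simp [hlW v hw]
    · simp [hlW' v hw]

/-- A relation supported on two disjoint linear subspaces splits into relations supported on each
of them, since a linear form on one of them extends to a linear form vanishing on the other. -/
theorem relation_split_of_disjoint {p : ι → E} {n : ℕ} {c : ι → k}
    (hc : c ∈ relations k p (n + 1)) {W W' : Submodule k E} (hdis : Disjoint W W')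
    (hsub : ∀ i ∈ supp c, p i ∈ W ∨ p i ∈ W') :
    (fun i => if p i ∈ W then 0 else c i) ∈ relations k p (n + 1) := by
  rw [mem_relations] at hc ⊢
  intro f hf
  rw [formVals, pow_succ'] at hf
  refine Submodule.mul_induction_on hf ?_ ?_
  · rintro _ ⟨u, rfl⟩ g hg
    obtain ⟨W'', hle, hcompl⟩ := hdis.exists_isCompl
    obtain ⟨h, hh, hh'⟩ : ∃ h : Dual k E, (∀ w ∈ W, h w = 0) ∧ ∀ w ∈ W', h w = u w := by
      refine ⟨LinearMap.ofIsCompl hcompl 0 (u.domRestrict W'), fun w hw => ?_, fun w hw => ?_⟩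
      · simpa using LinearMap.ofIsCompl_apply_left hcompl (φ := 0) (ψ := u.domRestrict W')
          ⟨w, hle hw⟩
      · simpa using LinearMap.ofIsCompl_apply_right hcompl (φ := 0) (ψ := u.domRestrict W') ⟨w, hw⟩
    have hg' : g ∈ formVals k p n := hg
    have h1 := hc _ (by simpa [add_comm] using mul_mem_formVals (linVals_mem p h) hg')
    refine Eq.trans (Finset.sum_congr rfl fun i _ => ?_) h1
    simp only [Pi.mul_apply, linVals_apply]
    split_ifs with hi
    · simp [hh _ hi]
    · by_cases hci : c i = 0
      · simp [hci]
      · rw [hh' _ ((hsub i (mem_supp.mpr hci)).resolve_left hi)]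
  · intro f g hf hg
    simp only [Pi.add_apply, mul_add, Finset.sum_add_distrib, hf, hg, add_zero]

/-- At most `3n - 1` points that carry a relation in degree `n` have `n + 2` points on a line or
`2n + 2` points on a plane conic. -/
theorem exists_line_or_conic [Infinite k] [FiniteDimensional k E] (hE : 3 ≤ finrank k E)
    {p : ι → E} (hp : DistinctPoints k p) {n : ℕ} {c : ι → k} (hc : c ∈ relations k p n)
    (h0 : c ≠ 0) (hcard : (supp c).card + 1 ≤ 3 * n) :
    (∃ W : Submodule k E, finrank k W ≤ 2 ∧
      n + 2 ≤ ((supp c).filter fun i => p i ∈ W).card) ∨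
    ∃ φ : (Fin 3 → k) →ₗ[k] E, Function.Injective φ ∧
      ∃ F ∈ formVals k (id : (Fin 3 → k) → (Fin 3 → k)) 2, F ≠ 0 ∧
        2 * n + 2 ≤ ((supp c).filter fun i => ∃ v, φ v = p i ∧ F v = 0).card := by
  induction n generalizing c with
  | zero => omega
  | succ n ih =>
  have hA := add_two_le_card_supp hp hc h0
  by_cases hres : ∃ l : Dual k E, 3 ≤ ((supp c).filter fun i => linVals p l i = 0).card ∧
      ∃ i ∈ supp c, l (p i) ≠ 0
  · -- The residual of the hyperplane `l = 0` has at most `3n - 1` points and a relation in degree `n`.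
    obtain ⟨l, hl3, i, hi, hli⟩ := hres
    have h1 := card_supp_mul c (linVals p l)
    have hsub := supp_mul_subset c (linVals p l)
    rcases ih (mul_linVals_mem_relations hc l) (ne_zero_of_mul_apply hi hli) (by omega) with
      ⟨W, hW, hcount⟩ | ⟨φ, hφ, F, hF, hF0, hcount⟩
    · have hcountW := hcount.trans (Finset.card_le_card (Finset.filter_subset_filter _ hsub))
      by_cases hmore : n + 1 + 2 ≤ ((supp c).filter fun i => p i ∈ W).card
      · exact Or.inl ⟨W, hW, hmore⟩
      -- Exactly `n + 2` points are on `W`. The at most `2n` others carry a relation in degree `n`,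
      -- given by a hyperplane that meets the points only in those on `W`, so they are collinear.
      obtain ⟨l', hker, hsep⟩ := exists_dual_separating (k := k) W p
      have hfil : ((supp c).filter fun i => linVals p l' i = 0) =
          (supp c).filter fun i => p i ∈ W := by
        refine Finset.filter_congr fun i _ => ⟨fun h => ?_, fun h => hker h⟩
        by_contra hiW
        exact hsep i hiW h
      have h2 := card_supp_mul c (linVals p l')
      rw [hfil] at h2
      have h0' : c * linVals p l' ≠ 0 := by
        intro h
        rw [h] at h2
        have : supp (0 : ι → k) = ∅ := by ext; simp
        rw [this, Finset.card_empty] at h2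
        omega
      have hc' := mul_linVals_mem_relations hc l'
      have hA' := add_two_le_card_supp hp hc' h0'
      obtain ⟨W', hW', hsub'⟩ := exists_line_of_card_supp_le hp hc' (by omega)
      have hor : ∀ i ∈ supp c, p i ∈ W ∨ p i ∈ W' := by
        intro i hi
        by_cases hiW : p i ∈ W
        · exact Or.inl hiW
        · exact Or.inr (hsub' i (mem_supp.mpr (mul_ne_zero (mem_supp.mp hi) (hsep i hiW))))
      by_cases hdis : Disjoint W W'
      · -- On skew lines the relation in degree `n + 1` restricts to `W'`, which therefore contains
        -- at least `n + 3` points.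
        left
        have h3 := relation_split_of_disjoint hc hdis hor
        have h4 : supp (fun i => if p i ∈ W then 0 else c i) = supp (c * linVals p l') := by
          ext i
          simp only [mem_supp, Pi.mul_apply, linVals_apply]
          by_cases hiW : p i ∈ W
          · simp [hiW, show l' (p i) = 0 from hker hiW]
          · simp [hiW, hsep i hiW]
        have h5 : (fun i => if p i ∈ W then 0 else c i) ≠ 0 := by
          intro h
          rw [h] at h4
          have : supp (0 : ι → k) = ∅ := by ext; simp
          rw [← h4, this, Finset.card_empty] at hA'
          omega
        have h6 := add_two_le_card_supp hp h3 h5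
        rw [h4] at h6
        refine ⟨W', hW', h6.trans (Finset.card_le_card fun i hi => ?_)⟩
        exact Finset.mem_filter.mpr ⟨supp_mul_subset _ _ hi, hsub' i hi⟩
      · right
        obtain ⟨φ, hφ, F, hF, hF0, hall⟩ := exists_conic_of_two_lines hE hW hW'
          (by rwa [disjoint_iff] at hdis)
        refine ⟨φ, hφ, F, hF, hF0, ?_⟩
        rw [Finset.filter_true_of_mem fun i hi => hall _ (hor i hi)]
        omega
    · have hcountC := hcount.trans (Finset.card_le_card (Finset.filter_subset_filter _ hsub))
      -- At most `n` points are off the conic, too few for a relation in degree `n` or `n - 1`. So all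
      -- points are in the plane of the conic, and then on the conic.
      have hrange : ∀ i ∈ supp c, p i ∈ LinearMap.range φ := by
        by_contra! hne
        obtain ⟨j, hj, hjr⟩ := hne
        obtain ⟨l', hl', hker⟩ := Submodule.exists_le_ker_of_notMem hjr
        have h2 := card_supp_mul c (linVals p l')
        have h3 := add_two_le_card_supp hp (mul_linVals_mem_relations hc l')
          (ne_zero_of_mul_apply hj hl')
        have h4 := Finset.card_le_card (Finset.monotone_filter_right (supp c)
          (p := fun i => ∃ v, φ v = p i ∧ F v = 0) (q := fun i => linVals p l' i = 0)
          fun i _ ⟨v, hv, _⟩ => hker ⟨v, hv⟩)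
        omega
      obtain ⟨ψ, hψ⟩ := φ.exists_leftInverse_of_injective (LinearMap.ker_eq_bot.mpr hφ)
      replace hψ : ∀ v, ψ (φ v) = v := fun v => LinearMap.congr_fun hψ v
      let g : ι → k := fun i => F (ψ (p i))
      have hg : g ∈ formVals k p 2 :=
        mem_formVals_iff.mpr ⟨_, pullback_mem_formVals ψ hF, fun _ => rfl⟩
      have hcg : c * g ∈ relations k p (n - 1) :=
        mul_mem_relations (a := 2) (by rwa [show 2 + (n - 1) = n + 1 by omega]) hg
      have h2 := card_supp_mul c g
      have h4 := Finset.card_le_card (Finset.monotone_filter_right (supp c)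
        (p := fun i => ∃ v, φ v = p i ∧ F v = 0) (q := fun i => g i = 0)
        fun i _ ⟨v, hv, hv'⟩ => by simp only [g, ← hv, hψ, hv'])
      have hz : c * g = 0 := by
        by_contra hne
        have h3 := add_two_le_card_supp hp hcg hne
        omega
      by_cases hsmall : (supp c).card ≤ 2 * (n + 1) + 1
      · obtain ⟨W, hW, hall⟩ := exists_line_of_card_supp_le hp hc hsmall
        refine Or.inl ⟨W, hW, ?_⟩
        rwa [Finset.filter_true_of_mem hall]
      · refine Or.inr ⟨φ, hφ, F, hF, hF0, ?_⟩
        rw [Finset.filter_true_of_mem]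
        · omega
        · intro i hi
          obtain ⟨v, hv⟩ := hrange i hi
          refine ⟨v, hv, ?_⟩
          have h5 := (mul_eq_zero.mp (congrFun hz i)).resolve_left (mem_supp.mp hi)
          simpa only [g, ← hv, hψ] using h5
  · -- Any subspace containing three of the points contains all of them.
    have hfull : ∀ W : Submodule k E, 3 ≤ ((supp c).filter fun i => p i ∈ W).card →
        ∀ i ∈ supp c, p i ∈ W := by
      intro W hW
      by_contra! hne
      obtain ⟨j, hj, hjW⟩ := hne
      obtain ⟨l, hl, hker⟩ := Submodule.exists_le_ker_of_notMem hjW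
      exact hres ⟨l, hW.trans (Finset.card_le_card
        (Finset.monotone_filter_right _ fun i _ h => hker h)), j, hj, hl⟩
    by_cases hcol : ∃ W : Submodule k E, finrank k W ≤ 2 ∧
        3 ≤ ((supp c).filter fun i => p i ∈ W).card
    · obtain ⟨W, hW, h3⟩ := hcol
      refine Or.inl ⟨W, hW, ?_⟩
      rwa [Finset.filter_true_of_mem (hfull W h3)]
    · right
      push Not at hcol
      obtain ⟨T, hT, hT3⟩ := Finset.exists_subset_card_eq (show 3 ≤ (supp c).card by omega)
      obtain ⟨φ, hφ, hle⟩ := exists_plane_embedding hE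
        (Submodule.span k (T.image p : Set E))
        ((finrank_span_finset_le_card _).trans (Finset.card_image_le.trans hT3.le))
      have hrange : ∀ i ∈ supp c, p i ∈ LinearMap.range φ := by
        refine hfull _ (hT3.symm.le.trans (Finset.card_le_card fun i hi => ?_))
        refine Finset.mem_filter.mpr ⟨hT hi, hle (Submodule.subset_span ?_)⟩
        exact Finset.mem_coe.mpr (Finset.mem_image_of_mem p hi)
      obtain ⟨ψ, hψ⟩ := φ.exists_leftInverse_of_injective (LinearMap.ker_eq_bot.mpr hφ)
      replace hψ : ∀ v, ψ (φ v) = v := fun v => LinearMap.congr_fun hψ v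
      let q : supp c → (Fin 3 → k) := fun i => ψ (p i)
      have hφq : ∀ i, φ (q i) = p i := by
        intro i
        obtain ⟨v, hv⟩ := hrange i i.2
        simp only [q, ← hv, hψ]
      have hq : DistinctPoints k q := by
        refine ⟨fun i h => hp.ne_zero i ?_, fun i j hij h => hp.notMem i j ?_ ?_⟩
        · rw [← hφq, h, map_zero]
        · exact fun h => hij (Subtype.ext h)
        · obtain ⟨t, ht⟩ := Submodule.mem_span_singleton.mp h
          rw [← hφq, ← hφq, ← ht, map_smul]
          exact Submodule.smul_mem _ _ (Submodule.mem_span_singleton_self _)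
      have hcard' : ∀ (Z : Finset (supp c)) (R : ι → Prop), (∀ i ∈ Z, R i) →
          Z.card ≤ ((supp c).filter R).card := by
        intro Z R hZ
        rw [← Finset.card_map (Function.Embedding.subtype _)]
        refine Finset.card_le_card fun i hi => ?_
        obtain ⟨j, hj, rfl⟩ := Finset.mem_map.mp hi
        exact Finset.mem_filter.mpr ⟨j.2, hZ j hj⟩
      have hgen : ∀ W : Submodule k (Fin 3 → k), finrank k W ≤ 2 →
          (Finset.univ.filter fun i => q i ∈ W).card ≤ 2 := by
        intro W hW
        have h1 := hcol (W.map φ) ((Submodule.finrank_map_le φ W).trans hW)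
        refine (hcard' _ _ fun i hi => ?_).trans (Nat.le_of_lt_succ h1)
        rw [← hφq]
        exact Submodule.mem_map_of_mem (Finset.mem_filter.mp hi).2
      have hcq : (fun i : supp c => c i) ∈ relations k q (n + 1) := by
        have h1 := relations_comp_subtype hc (supp c) subset_rfl
        rw [mem_relations] at h1 ⊢
        exact fun f hf => h1 f (formVals_comp_linear_le ψ _ _ hf)
      obtain ⟨j, hj⟩ := Function.ne_iff.mp h0
      obtain ⟨F, hF, hF0, hcount⟩ := exists_conic_of_no_three_collinear hq hgen hcq
        (fun h => hj (congrFun h ⟨j, mem_supp.mpr hj⟩)) (by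
          have := Finset.card_le_univ (supp fun i : supp c => c i)
          rw [Fintype.card_coe] at this
          omega)
      refine ⟨φ, hφ, F, hF, hF0, hcount.trans (hcard' _ _ fun i hi => ?_)⟩
      exact ⟨q i, hφq i, (Finset.mem_filter.mp hi).2⟩

theorem distinctPoints_rep {ι : Type*} {P : ι → ℙ k E} (hP : Function.Injective P) :
    DistinctPoints k fun i => (P i).rep := by
  refine ⟨fun i => (P i).rep_nonzero, fun i j hij h => hij (hP ?_)⟩
  obtain ⟨t, ht⟩ := Submodule.mem_span_singleton.mp h
  rw [← (P i).mk_rep, ← (P j).mk_rep, eq_comm, Projectivization.mk_eq_mk_iff']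
  exact ⟨t, ht⟩

/-- A linear dependence among evaluation maps yields a relation among the values of forms at
representatives of the points. -/
theorem exists_relation_of_not_inGeneralPosition {r s m : ℕ}
    {P : Fin s → ℙ k (Fin (r + 1) → k)} (h : ¬ InGeneralPosition m P) :
    ∃ c ∈ relations k (fun i => (P i).rep) m, c ≠ 0 := by
  obtain ⟨g, hg, i, hi⟩ := Fintype.not_linearIndependent_iff.mp h
  refine ⟨fun i => g i * ((P i).rep (leadIndex (P i).rep (P i).rep_nonzero) ^ m)⁻¹, ?_, ?_⟩
  · rw [mem_relations]
    intro f hf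
    obtain ⟨f', hf', hff'⟩ := mem_formVals_iff.mp hf
    obtain ⟨F, hF, hFf⟩ := mem_formVals_iff_exists_poly.mp hf'
    have h1 := LinearMap.congr_fun hg ⟨F, hF⟩
    rw [LinearMap.sum_apply, LinearMap.zero_apply] at h1
    rw [← h1]
    refine Finset.sum_congr rfl fun i _ => ?_
    simp only [evalAt, LinearMap.smul_apply, LinearMap.comp_apply, Submodule.subtype_apply,
      AlgHom.toLinearMap_apply, MvPolynomial.aeval_eq_eval, smul_eq_mul, hFf, hff', mul_assoc]
  · refine Function.ne_iff.mpr ⟨i, mul_ne_zero hi (inv_ne_zero (pow_ne_zero _ ?_))⟩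
    exact (leadIndex_spec _ _).1

end

end PointConfig

end

open PointConfig in
theorem proposition8p2 {k : Type*} [Field k] [IsAlgClosed k] (r m s : ℕ)
    (hr : 2 ≤ r) (hm : 1 ≤ m) (hs : s ≤ 3 * m - 1)
    (P : Fin s → ℙ k (Fin (r + 1) → k)) (hP : Function.Injective P)
    (hline : ∀ T : Finset (Fin s), T.card = m + 2 →
      ¬ Projectivization.IsCollinear (P '' (T : Set (Fin s))))
    (hconic : ∀ T : Finset (Fin s), T.card = 2 * m + 2 →
      ¬ ∃ C : Set (ℙ k (Fin (r + 1) → k)),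
        PointConfig.IsPlaneConic C ∧ P '' (T : Set (Fin s)) ⊆ C) :
    PointConfig.InGeneralPosition m P := by
  classical
  by_contra hdep
  have : Infinite k := IsAlgClosed.instInfinite
  obtain ⟨c, hc, h0⟩ := exists_relation_of_not_inGeneralPosition hdep
  have hcard := Finset.card_le_univ (supp c)
  rw [Fintype.card_fin] at hcard
  rcases exists_line_or_conic (by rw [Module.finrank_fin_fun]; omega) (distinctPoints_rep hP) hc h0
    (by omega) with ⟨W, hW, hcount⟩ | ⟨φ, hφ, F, hF, hF0, hcount⟩
  · obtain ⟨T, hT, hTcard⟩ := Finset.exists_subset_card_eq hcount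
    refine hline T hTcard ⟨W.projectivization, ?_, ?_, ?_⟩
    · rw [OrderIso.apply_symm_apply]
      infer_instance
    · rwa [OrderIso.apply_symm_apply]
    · rintro _ ⟨i, hi, rfl⟩
      rw [← (P i).mk_rep]
      exact (Submodule.mk_mem_projectivization_iff W _).mpr (Finset.mem_filter.mp (hT hi)).2
  · obtain ⟨T, hT, hTcard⟩ := Finset.exists_subset_card_eq hcount
    obtain ⟨G, hG, hGF⟩ := mem_formVals_iff_exists_poly.mp hF
    refine hconic T hTcard ⟨_, ⟨φ, hφ, G, ?_, hG, rfl⟩, ?_⟩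
    · rintro rfl
      exact hF0 (funext fun v => by simpa using (hGF v).symm)
    · rintro _ ⟨i, hi, rfl⟩
      obtain ⟨v, hv, hFv⟩ := (Finset.mem_filter.mp (hT hi)).2
      have hv0 : v ≠ 0 := by
        rintro rfl
        exact (P i).rep_nonzero (by rw [← hv, map_zero])
      refine ⟨Projectivization.mk k v hv0, (mk_mem_zeroLocus hG v hv0).mpr ((hGF v).trans hFv), ?_⟩
      rw [Projectivization.map_mk, ← (P i).mk_rep]
      congr 1
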